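/- Let $N\ge 2$ be an integer. For $a_1,\dots,a_n\in\mathbb{Z}/N\mathbb{Z}$ put \[M_n(a_1,\dots,a_n)=\begin{pmatrix}a_n&-1\\1&0\end{pmatrix}\begin{pmatrix}a_{n-1}&-1\\1&0\end{pmatrix}\cdots\begin{pmatrix}a_1&-1\\1&0\end{pmatrix},\] and call $(a_1,\dots,a_n)$ a solution of $(E_N)$ (of size $n$) if $M_n(a_1,\dots,a_n)=\pm\mathrm{Id}$ over $\mathbb{Z}/N\mathbb{Z}$. Define the sum of two tuples of sizes $n,m\ge 2$ by \[(a_1,\dots,a_n)\oplus(b_1,\dots,b_m)=(a_1+b_m,\,a_2,\dots,a_{n-1},\,a_n+b_1,\,b_2,\dots,b_{m-1}),\] and write $c\sim d$ if $d$ is a circular permutation of the tuple $c$ or of $c$ read backwards. A solution $c$ of size at least $3$ is reducible if there are a tuple $a$ of size at least $3$ and a solution $b$ of $(E_N)$ of size at least $3$ with $c\sim a\oplus b$. A solution is irreducible if it is not reducible; by convention $(0,0)$ is not considered irreducible. For $k\in\mathbb{Z}/N\mathbb{Z}$, the minimal $k$-monomial solution is the tuple $(k,\dots,k)$ of size $n$,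 where $n\ge 1$ is the smallest positive integer for which this tuple is a solution of $(E_N)$. The integer $N$ is called monomially irreducible if for every $k\neq 0$ in $\mathbb{Z}/N\mathbb{Z}$ the minimal $k$-monomial solution of $(E_N)$ is irreducible. Theorem. Every monomially irreducible integer $N$ with $2\le N\le 17440$ is prime or equal to $4$, $6$, $8$, $12$ or $24$. -/

import Mathlib

/-- The matrix `M_n(a_1, …, a_n) = T(a_n) * ⋯ * T(a_1)` with `T(a) = !![a, -1; 1, 0]`,
for a tuple `[a_1, …, a_n]` of elements of `ℤ/Nℤ`. -/
def monoMatrix {N : ℕ} : List (ZMod N) → Matrix (Fin 2) (Fin 2) (ZMod N)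
  | [] => 1
  | a :: l => monoMatrix l * !![a, -1; 1, 0]

/-- The tuple `c` is a solution of the equation `M_n(c_1, …, c_n) = ± Id` over `ℤ/Nℤ`;
its size is `c.length`. -/
def IsSolution {N : ℕ} (c : List (ZMod N)) : Prop :=
  monoMatrix c = 1 ∨ monoMatrix c = -1

/-- The sum of tuples
`(a_1, …, a_n) ⊕ (b_1, …, b_m) =
  (a_1 + b_m, a_2, …, a_{n-1}, a_n + b_1, b_2, …, b_{m-1})`.
It is only meaningful, and only used, for tuples of size at least `2`; the default values of
`headD` and `getLastD` are then never reached. -/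
def tupleSum {N : ℕ} (a b : List (ZMod N)) : List (ZMod N) :=
  (a.headD 0 + b.getLastD 0) :: (a.tail.dropLast ++
    (a.getLastD 0 + b.headD 0) :: b.tail.dropLast)

/-- `a ∼ b`: the tuple `b` is a circular permutation of `a` or of the reversed tuple of `a`. -/
def TupleEquiv {N : ℕ} (a b : List (ZMod N)) : Prop :=
  a.IsRotated b ∨ a.reverse.IsRotated b

/-- A solution `c` of size at least `3` is reducible if `c ∼ a ⊕ b` for a tuple `a` of size at
least `3` and a solution `b` of size at least `3`. -/
def IsReducibleSolution {N : ℕ} (c : List (ZMod N)) : Prop :=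
  IsSolution c ∧ 3 ≤ c.length ∧
    ∃ a b : List (ZMod N), IsSolution b ∧ 3 ≤ a.length ∧ 3 ≤ b.length ∧
      TupleEquiv c (tupleSum a b)

/-- A solution is irreducible if it is not reducible; by convention `(0, 0)` is not considered
to be irreducible. -/
def IsIrreducibleSolution {N : ℕ} (c : List (ZMod N)) : Prop :=
  IsSolution c ∧ c ≠ [0, 0] ∧ ¬ IsReducibleSolution c

/-- An `(n, k)`-monomial solution: an `n`-tuple, `n ≥ 1`, all of whose entries are `k`, that is
a solution. -/
def IsMonomialSolution {N : ℕ} (n : ℕ) (k : ZMod N) (c : List (ZMod N)) : Prop :=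
  1 ≤ n ∧ c = List.replicate n k ∧ IsSolution c

/-- The `k`-monomial minimal solution: an `(n, k)`-monomial solution with `n` the smallest
integer for which there is an `(n, k)`-monomial solution. -/
def IsMinimalMonomialSolution {N : ℕ} (k : ZMod N) (c : List (ZMod N)) : Prop :=
  ∃ n : ℕ, IsMonomialSolution n k c ∧
    ∀ (m : ℕ) (d : List (ZMod N)), IsMonomialSolution m k d → n ≤ m

/-- `N` (with `N ≥ 2`) is monomially irreducible if all nonzero minimal monomial solutions over
`ℤ/Nℤ` are irreducible. -/
def MonomiallyIrreducible (N : ℕ) : Prop :=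
  ∀ (k : ZMod N) (c : List (ZMod N)), k ≠ 0 →
    IsMinimalMonomialSolution k c → IsIrreducibleSolution c

/-!
Let `T = !![k, -1; 1, 0]` and let `S 0 = 0`, `S 1 = 1`, `S (i + 2) = k * S (i + 1) - S i`, so that
the entries of `T ^ i` are, up to sign, `S (i + 1)`, `S i`, `S (i - 1)`.  The tuple `(k, …, k)` of
size `n` is a solution when `T ^ n = ± 1`, and then `S` is periodic up to sign with period `n`.

If `S i = ± 1` with `2 ≤ i ≤ n - 2`, the tuple `(x, k, …, k, x)` of size `i + 1` with
`x = ± S (i - 1)` is a solution, and it splits off from `(k, …, k)`, which is thus reducible.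
By periodicity such an `i` exists as soon as there is any `i` with `S i = ± 1`, `S (i - 1) ≠ 0`
and `S (i + 1) ≠ 0`: the last two conditions say that `i` is not `± 1` modulo `n`.  This is
`not_monomiallyIrreducible_of_monoSeq`.  Two choices of `k` then suffice.

* If `l ^ 2 ∣ N` with `l ≥ 3`, take `k = N / l`.  Here `k ^ 2 = 0`, so `S 2 = k`, `S 3 = -1` and
  `S 4 = -2 * k`, and both neighbours of `S 3` are nonzero.
* If `N = a * b` with `a`, `b > 1` coprime and `a` coprime to `6`, take `k = 2` modulo `a` and
  `k = 1` modulo `b`.  Modulo `a` one has `S i = i`, while modulo `b` the sequence is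
  `0, 1, 1, 0, -1, -1`, repeated with period `6`.  An index `i` that is `1` modulo `a` and `2` modulo
  `6` gives `S i = 1`, with `S (i - 1) = 1` modulo `b` and `S (i + 1) = 2` modulo `a`.

A number to which neither applies is either prime or a divisor of `24`.
-/

/-! ### The sequence of continuants of a constant tuple -/

/-- The sequence `0, 1, k, k ^ 2 - 1, …` given by `S (i + 2) = k * S (i + 1) - S i`.  For `i ≥ 1` the term of
index `i` is the continuant of the constant tuple `(k, …, k)` of size `i - 1`. -/
def monoSeq {R : Type*} [CommRing R] (k : R) : ℕ → R
  | 0 => 0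
  | 1 => 1
  | i + 2 => k * monoSeq k (i + 1) - monoSeq k i

theorem map_monoSeq {R R' : Type*} [CommRing R] [CommRing R'] (f : R →+* R') (k : R) (i : ℕ) :
    f (monoSeq k i) = monoSeq (f k) i := by
  induction i using Nat.twoStepInduction with
  | zero => simp [monoSeq]
  | one => simp [monoSeq]
  | more i h₀ h₁ => simp [monoSeq, h₀, h₁]

theorem monoSeq_two {R : Type*} [CommRing R] (i : ℕ) : monoSeq (2 : R) i = i := by
  induction i using Nat.twoStepInduction with
  | zero => simp [monoSeq]
  | one => simp [monoSeq]
  | more i h₀ h₁ =>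
    simp only [monoSeq, h₀, h₁]
    push_cast
    ring

theorem monoSeq_one_add_six {R : Type*} [CommRing R] (i : ℕ) :
    monoSeq (1 : R) (i + 6) = monoSeq (1 : R) i := by
  simp only [monoSeq]
  ring

theorem monoSeq_one_six_mul_add {R : Type*} [CommRing R] (q r : ℕ) :
    monoSeq (1 : R) (6 * q + r) = monoSeq (1 : R) r := by
  induction q with
  | zero => simp
  | succ q ih => rw [← ih, ← monoSeq_one_add_six (6 * q + r)]; congr 1; ring

theorem monoSeq_det {R : Type*} [CommRing R] (k : R) (i : ℕ) :
    monoSeq k (i + 1) ^ 2 - monoSeq k (i + 2) * monoSeq k i = 1 := by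
  induction i with
  | zero => simp [monoSeq]
  | succ i ih =>
    rw [← ih]
    simp only [monoSeq]
    ring

theorem pow_succ_eq_monoSeq {R : Type*} [CommRing R] (k : R) (i : ℕ) :
    (!![k, -1; 1, 0] : Matrix (Fin 2) (Fin 2) R) ^ (i + 1) =
      !![monoSeq k (i + 2), -monoSeq k (i + 1); monoSeq k (i + 1), -monoSeq k i] := by
  induction i with
  | zero => simp [monoSeq]
  | succ i ih =>
    rw [pow_succ', ih]
    ext a b
    fin_cases a <;> fin_cases b <;> simp [monoSeq, Matrix.mul_apply, Fin.sum_univ_two] <;> ring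

theorem pow_apply_one_zero {R : Type*} [CommRing R] (k : R) (i : ℕ) :
    ((!![k, -1; 1, 0] : Matrix (Fin 2) (Fin 2) R) ^ i) 1 0 = monoSeq k i := by
  cases i with
  | zero => simp [monoSeq]
  | succ i => simp [pow_succ_eq_monoSeq]

/-- If `T ^ n = ± 1`, then the sequence has period `n` up to a sign. -/
theorem monoSeq_add_mul {R : Type*} [CommRing R] {k : R} {n : ℕ}
    (h : (!![k, -1; 1, 0] : Matrix (Fin 2) (Fin 2) R) ^ n = 1 ∨
      (!![k, -1; 1, 0] : Matrix (Fin 2) (Fin 2) R) ^ n = -1) (q : ℕ) :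
    (∀ r, monoSeq k (r + n * q) = monoSeq k r) ∨ ∀ r, monoSeq k (r + n * q) = -monoSeq k r := by
  have h' : (!![k, -1; 1, 0] : Matrix (Fin 2) (Fin 2) R) ^ (n * q) = 1 ∨
      (!![k, -1; 1, 0] : Matrix (Fin 2) (Fin 2) R) ^ (n * q) = -1 := by
    rw [pow_mul]
    rcases h with h | h
    · simp [h]
    · rw [h]; exact neg_one_pow_eq_or _ q
  refine h'.imp (fun h r => ?_) fun h r => ?_
  · rw [← pow_apply_one_zero, pow_add, h, mul_one, pow_apply_one_zero]
  · rw [← pow_apply_one_zero, pow_add, h, mul_neg, mul_one, Matrix.neg_apply, pow_apply_one_zero]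

/-! ### Reducible constant tuples -/

theorem monoMatrix_append {N : ℕ} (a b : List (ZMod N)) :
    monoMatrix (a ++ b) = monoMatrix b * monoMatrix a := by
  induction a with
  | nil => simp [monoMatrix]
  | cons x a ih => simp [monoMatrix, ih, mul_assoc]

theorem monoMatrix_replicate {N : ℕ} (n : ℕ) (k : ZMod N) :
    monoMatrix (List.replicate n k) = !![k, -1; 1, 0] ^ n := by
  induction n with
  | zero => simp [monoMatrix]
  | succ n ih => rw [List.replicate_succ, monoMatrix, ih, pow_succ]

/-- A continuant equal to `e = ± 1` allows one to close the tuple `(k, …, k)` to a solution by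
adding the same entry at both ends. -/
theorem isSolution_of_monoSeq {N : ℕ} {k e : ZMod N} (he : e = 1 ∨ e = -1) {j : ℕ}
    (hj : monoSeq k (j + 2) = e) :
    IsSolution (e * monoSeq k (j + 1) ::
      (List.replicate (j + 1) k ++ [e * monoSeq k (j + 1)])) := by
  have hdet := monoSeq_det k j
  have he2 : e * e = 1 := by rcases he with rfl | rfl <;> ring
  have key : monoMatrix (e * monoSeq k (j + 1) ::
      (List.replicate (j + 1) k ++ [e * monoSeq k (j + 1)])) = !![-e, 0; 0, -e] := by
    rw [monoMatrix, monoMatrix_append, monoMatrix_replicate, pow_succ_eq_monoSeq]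
    rw [hj] at hdet ⊢
    generalize monoSeq k (j + 1) = s at *
    generalize monoSeq k j = t at *
    ext a b
    fin_cases a <;> fin_cases b <;>
      simp [monoMatrix, Matrix.mul_apply, Fin.sum_univ_two] <;> grind
  rw [IsSolution, key]
  rcases he with rfl | rfl
  · right
    ext a b
    fin_cases a <;> fin_cases b <;> simp
  · left
    ext a b
    fin_cases a <;> fin_cases b <;> simp

/-- The indices are shifted to avoid subtraction: `i = j + 2` satisfies `2 ≤ i ≤ n - 2` for
`n = j + m + 4`. -/
theorem isReducibleSolution_replicate {N : ℕ} {k : ZMod N} {j m : ℕ}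
    (hsol : IsSolution (List.replicate (j + m + 4) k))
    (hj : monoSeq k (j + 2) = 1 ∨ monoSeq k (j + 2) = -1) :
    IsReducibleSolution (List.replicate (j + m + 4) k) := by
  obtain ⟨x, hx⟩ : ∃ x, x = monoSeq k (j + 2) * monoSeq k (j + 1) := ⟨_, rfl⟩
  refine ⟨hsol, by simp, (k - x) :: (List.replicate (m + 1) k ++ [k - x]),
    x :: (List.replicate (j + 1) k ++ [x]), ?_, by simp, by simp, Or.inl ?_⟩
  · rw [hx]
    exact isSolution_of_monoSeq hj rfl
  · have : tupleSum ((k - x) :: (List.replicate (m + 1) k ++ [k - x]))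
        (x :: (List.replicate (j + 1) k ++ [x])) = List.replicate (j + m + 4) k := by
      rw [List.eq_replicate_iff]
      constructor
      · simp [tupleSum]; ring
      · intro b hb
        simp only [tupleSum, List.headD_cons, List.tail_cons, List.dropLast_concat,
          List.mem_cons, List.mem_append, List.mem_replicate, List.getLastD_cons,
          List.getLastD_concat] at hb
        rcases hb with hb | hb | hb | hb
        · rw [hb]; ring
        · exact hb.2
        · rw [hb]; ring
        · exact hb.2
    rw [this]

theorem exists_isMinimalMonomialSolution {N : ℕ} [NeZero N] (k : ZMod N) :
    ∃ n : ℕ, 1 ≤ n ∧ IsSolution (List.replicate n k) ∧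
      IsMinimalMonomialSolution k (List.replicate n k) := by
  classical
  have hex : ∃ n : ℕ, 1 ≤ n ∧ IsSolution (List.replicate n k) := by
    have hu : IsUnit (!![k, -1; 1, 0] : Matrix (Fin 2) (Fin 2) (ZMod N)) := by
      rw [Matrix.isUnit_iff_isUnit_det]
      simp [Matrix.det_fin_two]
    obtain ⟨u, hu⟩ := hu
    obtain ⟨n, hn, hn1⟩ := (isOfFinOrder_of_finite u).exists_pow_eq_one
    refine ⟨n, hn, Or.inl ?_⟩
    rw [monoMatrix_replicate, ← hu, ← Units.val_pow_eq_pow_val, hn1, Units.val_one]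
  obtain ⟨h1, hs⟩ := Nat.find_spec hex
  refine ⟨Nat.find hex, h1, hs, Nat.find hex, ⟨h1, rfl, hs⟩, ?_⟩
  rintro m d ⟨hm, rfl, hd⟩
  exact Nat.find_min' hex ⟨hm, hd⟩

/-- A term `± 1` of the sequence with nonzero neighbours makes the minimal solution reducible. -/
theorem not_monomiallyIrreducible_of_monoSeq {N : ℕ} (hN : 2 ≤ N) {k : ZMod N} (hk : k ≠ 0) {i : ℕ}
    (hi : monoSeq k (i + 1) = 1 ∨ monoSeq k (i + 1) = -1) (h₀ : monoSeq k i ≠ 0)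
    (h₂ : monoSeq k (i + 2) ≠ 0) : ¬ MonomiallyIrreducible N := by
  intro hirr
  have : NeZero N := ⟨by omega⟩
  have : Fact (1 < N) := ⟨hN⟩
  obtain ⟨n, hn, hs, hmin⟩ := exists_isMinimalMonomialSolution k
  refine (hirr k _ hk hmin).2.2 ?_
  have hT := hs
  rw [IsSolution, monoMatrix_replicate] at hT
  have hzero : ∀ q, monoSeq k (n * q) = 0 := fun q => by
    rcases monoSeq_add_mul hT q with h | h <;> simpa [monoSeq] using h 0
  obtain ⟨q, r, hqr, hr⟩ : ∃ q r, i + 1 = r + n * q ∧ r < n :=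
    ⟨(i + 1) / n, (i + 1) % n, (Nat.mod_add_div _ _).symm, Nat.mod_lt _ hn⟩
  have hr0 : r ≠ 0 := by
    rintro rfl
    rw [hqr, zero_add, hzero] at hi
    rcases hi with hi | hi <;> simp at hi
  have hr1 : r ≠ 1 := by
    rintro rfl
    exact h₀ (by rw [show i = n * q by omega, hzero])
  have hr2 : r + 1 ≠ n := by
    intro h
    refine h₂ ?_
    rw [show i + 2 = n * (q + 1) by rw [mul_add, mul_one]; omega, hzero]
  obtain ⟨j, rfl⟩ : ∃ j, r = j + 2 := ⟨r - 2, by omega⟩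
  obtain ⟨m, rfl⟩ : ∃ m, n = j + m + 4 := ⟨n - j - 4, by omega⟩
  refine isReducibleSolution_replicate hs ?_
  rw [hqr] at hi
  rcases monoSeq_add_mul hT q with h | h
  · rwa [h] at hi
  · rw [h] at hi
    rcases hi with hi | hi
    · exact Or.inr (by rw [← hi, neg_neg])
    · exact Or.inl (neg_injective hi)

/-! ### Two families of moduli that are not monomially irreducible -/

theorem not_monomiallyIrreducible_of_sq_dvd {N l : ℕ} (hN : 2 ≤ N) (hl : 3 ≤ l)
    (h : l ^ 2 ∣ N) : ¬ MonomiallyIrreducible N := by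
  obtain ⟨m, rfl⟩ := h
  have hm : 0 < m := Nat.pos_of_ne_zero (by rintro rfl; simp at hN)
  have hsq : (((l * m : ℕ) : ZMod (l ^ 2 * m))) ^ 2 = 0 := by
    rw [← Nat.cast_pow, ZMod.natCast_eq_zero_iff]
    exact ⟨m, by ring⟩
  have h2 : (2 : ZMod (l ^ 2 * m)) * ((l * m : ℕ) : ZMod (l ^ 2 * m)) ≠ 0 := by
    rw [Ne, show (2 : ZMod (l ^ 2 * m)) * ((l * m : ℕ) : ZMod (l ^ 2 * m)) =
      ((2 * (l * m) : ℕ) : ZMod (l ^ 2 * m)) by push_cast; rfl, ZMod.natCast_eq_zero_iff]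
    intro hd
    have := Nat.le_of_dvd (by positivity) hd
    nlinarith [Nat.mul_pos (show 0 < l by omega) hm]
  generalize ((l * m : ℕ) : ZMod (l ^ 2 * m)) = k at hsq h2
  have hk : k ≠ 0 := by rintro rfl; simp at h2
  refine not_monomiallyIrreducible_of_monoSeq hN hk (i := 2) (Or.inr ?_) ?_ ?_
  · simp only [monoSeq]
    linear_combination hsq
  · simpa [monoSeq] using hk
  · intro h0
    refine h2 ?_
    simp only [monoSeq] at h0
    linear_combination k * hsq - h0

theorem not_monomiallyIrreducible_of_coprime {a b : ℕ} (ha : 1 < a) (hb : 1 < b)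
    (hab : a.Coprime b) (ha6 : a.Coprime 6) : ¬ MonomiallyIrreducible (a * b) := by
  have : Fact (1 < a) := ⟨ha⟩
  have : Fact (1 < b) := ⟨hb⟩
  obtain ⟨f, -⟩ : ∃ f : ZMod (a * b) ≃+* ZMod a × ZMod b, f = ZMod.chineseRemainder hab :=
    ⟨_, rfl⟩
  obtain ⟨i, hia, hi6⟩ := Nat.chineseRemainder ha6 0 1
  obtain ⟨q, rfl⟩ : ∃ q, i = 6 * q + 1 := ⟨i / 6, by unfold Nat.ModEq at hi6; omega⟩
  have hia' : (((6 * q + 1 : ℕ)) : ZMod a) = 0 := by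
    rw [ZMod.natCast_eq_zero_iff]
    exact (Nat.modEq_zero_iff_dvd).1 hia
  have hS : ∀ s, f (monoSeq (f.symm (2, 1)) s) = ((s : ZMod a), monoSeq (1 : ZMod b) s) := by
    intro s
    have h := map_monoSeq (f : ZMod (a * b) →+* ZMod a × ZMod b) (f.symm (2, 1)) s
    simp only [RingEquiv.coe_toRingHom, RingEquiv.apply_symm_apply] at h
    rw [h]
    have h1 := map_monoSeq (RingHom.fst (ZMod a) (ZMod b)) (2, 1) s
    have h2 := map_monoSeq (RingHom.snd (ZMod a) (ZMod b)) (2, 1) s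
    exact Prod.ext (h1.trans (monoSeq_two s)) h2
  refine not_monomiallyIrreducible_of_monoSeq (k := f.symm (2, 1)) (i := 6 * q + 1)
    (by nlinarith) ?_ (Or.inl ?_) ?_ ?_
  · rw [Ne, map_eq_zero_iff f.symm f.symm.injective]
    intro h
    exact one_ne_zero (congrArg Prod.snd h)
  · apply f.injective
    rw [hS, map_one]
    refine Prod.ext ?_ ?_
    · rw [Nat.cast_succ, hia']
      simp
    · exact (monoSeq_one_six_mul_add q 2).trans (by simp [monoSeq])
  · intro h
    have := congrArg Prod.snd ((hS _).symm.trans (congrArg f h))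
    rw [map_zero] at this
    exact one_ne_zero (((monoSeq_one_six_mul_add q 1).trans (by simp [monoSeq])).symm.trans this)
  · intro h
    have h0 := congrArg Prod.fst ((hS _).symm.trans (congrArg f h))
    rw [map_zero] at h0
    have h2 : ((2 : ℕ) : ZMod a) = 0 := by
      have : (((6 * q + 1 + 2 : ℕ)) : ZMod a) = 0 := h0
      rwa [Nat.cast_add, hia', zero_add] at this
    rw [ZMod.natCast_eq_zero_iff] at h2
    -- `a ∣ 2` and `a` coprime to `6` force `a = 1`.
    have := Nat.Coprime.eq_one_of_dvd ha6 (h2.trans (by norm_num))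
    omega

/-! ### Classification of the remaining moduli -/

theorem not_monomiallyIrreducible_of_prime_dvd {N p : ℕ} (hN : 2 ≤ N) (hNp : ¬ N.Prime)
    (hp : p.Prime) (hp5 : 5 ≤ p) (hpN : p ∣ N) : ¬ MonomiallyIrreducible N := by
  obtain ⟨e, b, hb, rfl⟩ := Nat.exists_eq_pow_mul_and_not_dvd (n := N) (by omega) p hp.ne_one
  have he : e ≠ 0 := by
    rintro rfl
    exact hb (by simpa using hpN)
  have hb0 : b ≠ 0 := by rintro rfl; simp at hb
  by_cases hb1 : b = 1
  · subst hb1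
    have he1 : e ≠ 1 := by
      rintro rfl
      exact hNp (by simpa using hp)
    exact not_monomiallyIrreducible_of_sq_dvd hN (l := p) (by omega)
      ((pow_dvd_pow p (by omega)).mul_right _)
  · refine not_monomiallyIrreducible_of_coprime (Nat.one_lt_pow he hp.one_lt) (by omega)
      (Nat.Coprime.pow_left _ ((Nat.Prime.coprime_iff_not_dvd hp).2 hb))
      (Nat.Coprime.pow_left _ ((Nat.Prime.coprime_iff_not_dvd hp).2 fun h => ?_))
    rw [show 6 = 2 * 3 from rfl, hp.dvd_mul] at h
    rcases h with h | h <;> have := Nat.le_of_dvd (by norm_num) h <;> omega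

theorem dvd_twentyFour_of_not_dvd {N : ℕ} (hN : N ≠ 0) (h : ∀ p, p.Prime → p ∣ N → p < 5)
    (h9 : ¬ 9 ∣ N) (h16 : ¬ 16 ∣ N) : N ∣ 24 := by
  obtain ⟨u, s, hs, rfl⟩ := Nat.exists_eq_pow_mul_and_not_dvd hN 2 (by norm_num)
  have hs0 : s ≠ 0 := by rintro rfl; simp at hs
  obtain ⟨v, r, hr, rfl⟩ := Nat.exists_eq_pow_mul_and_not_dvd hs0 3 (by norm_num)
  have hr1 : r = 1 := by
    by_contra hr1
    have hp := Nat.minFac_prime hr1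
    have hd := Nat.minFac_dvd r
    have hlt := h _ hp ((hd.mul_left _).mul_left _)
    have h2 : r.minFac ≠ 2 := fun h2 => hs ((h2 ▸ hd).mul_left _)
    have h3 : r.minFac ≠ 3 := fun h3 => hr (h3 ▸ hd)
    have h4 : r.minFac ≠ 4 := fun h4 => by rw [h4] at hp; norm_num at hp
    have := hp.two_le
    omega
  subst hr1
  have hu : u ≤ 3 := by
    by_contra! hu
    exact h16 ((pow_dvd_pow 2 (show 4 ≤ u by omega)).mul_right _)
  have hv : v ≤ 1 := by
    by_contra! hv
    exact h9 (((pow_dvd_pow 3 (show 2 ≤ v by omega)).mul_right _).mul_left _)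
  rw [mul_one]
  exact mul_dvd_mul (pow_dvd_pow 2 hu) (pow_dvd_pow 3 hv)

theorem mainTheorem12 (N : ℕ) (hN : 2 ≤ N) (hN' : N ≤ 17440)
    (hirr : MonomiallyIrreducible N) :
    N.Prime ∨ N = 4 ∨ N = 6 ∨ N = 8 ∨ N = 12 ∨ N = 24 := by
  by_cases hNp : N.Prime
  · exact Or.inl hNp
  have hd : N ∣ 24 := by
    refine dvd_twentyFour_of_not_dvd (by omega) (fun p hp hpN => ?_) (fun h => ?_) fun h => ?_
    · by_contra! hp5
      exact not_monomiallyIrreducible_of_prime_dvd hN hNp hp hp5 hpN hirr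
    · exact not_monomiallyIrreducible_of_sq_dvd hN (l := 3) le_rfl (by simpa using h) hirr
    · exact not_monomiallyIrreducible_of_sq_dvd hN (l := 4) (by norm_num) (by simpa using h) hirr
  have h24 : N ≤ 24 := Nat.le_of_dvd (by norm_num) hd
  have h2 : N ≠ 2 := by rintro rfl; exact hNp Nat.prime_two
  have h3 : N ≠ 3 := by rintro rfl; exact hNp Nat.prime_three
  interval_cases N <;> omega
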